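/- Consider lattice walks that start at $(0,0)$, take steps in $\{N,SE,SW\}=\{(0,1),(1,-1),(-1,-1)\}$ and stay in the quarter plane $\{(i,j): i\ge 0,\ j\ge 0\}$. Let $Q_8(x,y;t)$ be their complete generating function: the coefficient of $x^iy^jt^n$ is the number of such walks of length $n$ ending at $(i,j)$. Let $H(x,t)\in\mathbb{Q}[x][[t]]$ be the power series that contains only odd powers of $t$ and whose coefficients, for $n\ge 1$ and $k\ge 0$, are $$[x^kt^{2n-1}]H(x,t)=\begin{cases}\dfrac{k}{n+1}\dbinom{n+1}{(n+k+1)/2}\,C_{n-1} & \text{if } k\not\equiv n \pmod 2,\\ 0 & \text{if } k\equiv n \pmod 2,\end{cases}\qquad C_m=\frac1{m+1}\binom{2m}{m}.$$ Let $$M(y,t)=\frac{1}{2t}\Bigl(y-ty^2-\sqrt{y^2-2y^3t+t^2y^4-4t^2}\Bigr),$$ where the square root is the power series in $t$ over $\mathbb{Q}[y,y^{-1}]$ with constant term $y$. Then $M$ is a well-defined element of $\mathbb{Q}[y,y^{-1}][[t]]$. It is algebraic, with $tM^2-(y-ty^2)M+t=0$, and $$M(y,t)=y^{-1}t+t^2+(y+y^{-3})t^3+(y^2+3y^{-2})t^4+O(t^5).$$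 Moreover, in the ring $\mathbb{Q}[x,x^{-1},y,y^{-1}][[t]]$, the series $xy-txy^2-t(x^2+1)$ is invertible and $$Q_8(x,y;t)=\frac{xy-H(x,t)-y\,M(y,t)+H(M(y,t),t)}{xy-txy^2-t(x^2+1)}.$$ -/

import Mathlib

noncomputable section

/-- A walk in the quarter plane with steps from `Y`: a finite sequence of steps of `Y`, all of
whose partial vector sums have nonnegative coordinates. -/
def IsQuarterPlaneWalk (Y : Finset (ℤ × ℤ)) (w : List (ℤ × ℤ)) : Prop :=
  (∀ s ∈ w, s ∈ Y) ∧ ∀ k ≤ w.length, 0 ≤ (w.take k).sum.1 ∧ 0 ≤ (w.take k).sum.2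

/-- The set of quarter plane walks with steps from `Y`, of length `n`, ending at `p`. -/
def walksTo (Y : Finset (ℤ × ℤ)) (n : ℕ) (p : ℤ × ℤ) : Set (List (ℤ × ℤ)) :=
  {w | IsQuarterPlaneWalk Y w ∧ w.length = n ∧ w.sum = p}

lemma finite_walks (Y : Finset (ℤ × ℤ)) (n : ℕ) :
    {w : List (ℤ × ℤ) | IsQuarterPlaneWalk Y w ∧ w.length = n}.Finite := by
  refine ((List.finite_length_eq Y n).image (List.map Subtype.val)).subset ?_
  rintro w ⟨⟨hY, -⟩, hn⟩
  refine ⟨w.attach.map fun s => ⟨s.1, hY s.1 s.2⟩, by simpa using hn, ?_⟩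
  simpa [List.map_map, Function.comp_def] using List.attach_map_subtype_val w

lemma finite_support_walksTo (Y : Finset (ℤ × ℤ)) (n : ℕ) :
    (Function.support fun p => ((walksTo Y n p).ncard : ℚ)).Finite := by
  refine ((finite_walks Y n).image List.sum).subset ?_
  intro p hp
  have h0 : (walksTo Y n p).ncard ≠ 0 := by simpa using hp
  obtain ⟨w, hw⟩ := Set.nonempty_of_ncard_ne_zero h0
  exact ⟨w, ⟨hw.1, hw.2.1⟩, hw.2.2⟩

/-- Laurent polynomials in `x`, `y` over `ℚ`; the exponent of `x^i y^j` is `(i, j)`. -/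
abbrev LaurentXY : Type := AddMonoidAlgebra ℚ (ℤ × ℤ)

/-- The Laurent monomial `x^i y^j`. -/
def mon (i j : ℤ) : LaurentXY := AddMonoidAlgebra.single (i, j) 1

/-- The ring `ℚ[x, x⁻¹, y, y⁻¹][[t]]`, in which all the series below live. -/
abbrev LaurentXYSeries : Type := PowerSeries LaurentXY

/-- The series `x`. -/
def xS : LaurentXYSeries := PowerSeries.C (mon 1 0)

/-- The series `y`. -/
def yS : LaurentXYSeries := PowerSeries.C (mon 0 1)

/-- The series `t`. -/
def tS : LaurentXYSeries := PowerSeries.X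

/-- The complete generating function `Q_Y(x, y; t)`: the coefficient of `x^i y^j t^n` is the number
of quarter plane walks with steps from `Y`, of length `n`, ending at `(i, j)`. -/
def completeGF (Y : Finset (ℤ × ℤ)) : LaurentXYSeries :=
  PowerSeries.mk fun n => AddMonoidAlgebra.ofCoeff
    (Finsupp.ofSupportFinite (fun p => ((walksTo Y n p).ncard : ℚ)) (finite_support_walksTo Y n))

lemma coeff_completeGF (Y : Finset (ℤ × ℤ)) (n : ℕ) (i j : ℤ) :
    (PowerSeries.coeff n (completeGF Y)).coeff (i, j) = ((walksTo Y n (i, j)).ncard : ℚ) := by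
  simp [completeGF, Finsupp.ofSupportFinite_coe]

/-- The step set `{N, SE, SW}`. -/
def stepsNSESW : Finset (ℤ × ℤ) := {(0, 1), (1, -1), (-1, -1)}

/-- For `n ≥ 1`, the coefficient of `x^k t^(2n-1)` in `H(x, t)`: it is
`C_{n-1} * k / (n+1) * binom (n+1) ((n+k+1)/2)`, `C_m` the `m`-th Catalan number, if `n` and `k`
have different parities, and zero otherwise. -/
def hCoeff (n k : ℕ) : ℚ :=
  if k % 2 = n % 2 then 0
  else (catalan (n - 1) : ℚ) * ((k : ℚ) / ((n : ℚ) + 1)) * ((n + 1).choose ((n + k + 1) / 2) : ℚ)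

/-- The series `H(x, t)`, as an element of `ℚ[x][[t]]`. Only odd powers of `t` occur; the
coefficient of `t^(2n-1)` is a polynomial of degree at most `n + 1`. -/
def hSeries : PowerSeries (Polynomial ℚ) :=
  PowerSeries.mk fun m =>
    if m % 2 = 1 then
      ∑ k ∈ Finset.range ((m + 1) / 2 + 2), Polynomial.monomial k (hCoeff ((m + 1) / 2) k)
    else 0

lemma coeff_hSeries_odd (n k : ℕ) (hn : 1 ≤ n) :
    (PowerSeries.coeff (2 * n - 1) hSeries).coeff k = hCoeff n k := by
  have h1 : (2 * n - 1) % 2 = 1 := by omega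
  have h2 : (2 * n - 1 + 1) / 2 = n := by omega
  simp only [hSeries, PowerSeries.coeff_mk, h1, h2, if_true, Polynomial.finsetSum_coeff,
    Polynomial.coeff_monomial, Finset.sum_ite_eq', Finset.mem_range]
  split_ifs with hk
  · rfl
  · unfold hCoeff
    split_ifs with hp
    · rfl
    · rw [Nat.choose_eq_zero_of_lt (by omega)]
      simp

lemma coeff_hSeries_even (n : ℕ) : PowerSeries.coeff (2 * n) hSeries = 0 := by
  simp [hSeries]

/-- Substitution `F(G, t)` of a series `G` for the variable `x` in `F(x, t) = ∑ f_m(x) t^m` in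
`ℚ[x][[t]]`: the (`t`-adically convergent) sum `∑ f_m(G) t^m`, computed coefficientwise in `t`. -/
def substX (F : PowerSeries (Polynomial ℚ)) (G : LaurentXYSeries) : LaurentXYSeries :=
  PowerSeries.mk fun n => ∑ p ∈ Finset.HasAntidiagonal.antidiagonal n,
    PowerSeries.coeff p.2 (Polynomial.aeval G (PowerSeries.coeff p.1 F))

/-- `M = (y - t y² - √(y² - 2 y³ t + t² y⁴ - 4 t²)) / (2 t)`, where `√` denotes the square root,
as a power series in `t`, with constant term `y`. -/
def IsM (M : LaurentXYSeries) : Prop :=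
  ∃ S : LaurentXYSeries,
    S ^ 2 = yS ^ 2 - 2 * yS ^ 3 * tS + tS ^ 2 * yS ^ 4 - 4 * tS ^ 2 ∧
    PowerSeries.constantCoeff S = mon 0 1 ∧
    2 * tS * M = yS - tS * yS ^ 2 - S

/-- The denominator `x y - t x y² - t (x² + 1)`. -/
def kernelNSESW : LaurentXYSeries := xS * yS - tS * xS * yS ^ 2 - tS * (xS ^ 2 + 1)

end

/-! This is the kernel method with an explicit boundary term. Deleting the last step of a walk gives
`(xy - txy² - t(x²+1)) Q = xy - H - t Q(0,y)`, where `H` must equal `t(x²+1)Q(x,0) - tQ(0,0)`: it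
removes the downward steps taken from the x-axis, apart from the SW steps from the origin, which
`tQ(0,y)` already removes. The series `M` is the root in `x` of the kernel that is a power series in
`t`. Putting `x = M` therefore kills the left side and gives `tQ(0,y) = yM - H(M,t)`, and division
by the kernel, a unit with constant term `xy`, yields the formula.

That the explicit `H` is this boundary term follows from a product formula
(`ncard_walksTo_stepsNSESW`): the height performs a ballot walk, and the abscissa performs one along
its down steps. On the axis this gives a Catalan number times a ballot number
(`ncard_walksTo_boundary`). The substitution is justified by `diagEval`, and the two evaluations at
`x` and at `M` are instances of `diagEval_functional_equation`. -/

/-! ### Ballot numbers. -/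

/-- The number of walks on `ℤ` with steps `±1` of length `n` from `0` to `j`, all of whose
positions are nonnegative. -/
def ballot : ℕ → ℤ → ℕ
  | 0, j => if j = 0 then 1 else 0
  | n + 1, j => if 0 ≤ j then ballot n (j - 1) + ballot n (j + 1) else 0

lemma ballot_of_neg (n : ℕ) {j : ℤ} (hj : j < 0) : ballot n j = 0 := by
  cases n with
  | zero => simp [ballot, hj.ne]
  | succ n => simp [ballot, hj]

lemma ballot_of_lt (n : ℕ) : ∀ {j : ℤ}, (n : ℤ) < j → ballot n j = 0 := by
  induction n with
  | zero => intro j hj; simp [ballot]; push_cast at hj; omega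
  | succ n ih =>
    intro j hj
    push_cast at hj
    rw [ballot, ih (by omega), ih (by omega)]
    simp

lemma ballot_of_odd (n : ℕ) : ∀ {j : ℤ}, (n + j) % 2 = 1 → ballot n j = 0 := by
  induction n with
  | zero => intro j hj; simp [ballot]; push_cast at hj; omega
  | succ n ih =>
    intro j hj
    push_cast at hj
    rw [ballot, ih (by omega), ih (by omega)]
    simp

lemma ballot_self (n : ℕ) : ballot n n = 1 := by
  induction n with
  | zero => simp [ballot]
  | succ n ih =>
    rw [ballot, if_pos (by positivity), ballot_of_lt (j := ((n + 1 : ℕ) : ℤ) + 1) n (by push_cast; omega)]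
    simpa using ih

/-- The reflection formula for paths with `e + 1` down steps, obtained here from Pascal's rule by
double induction. -/
lemma ballot_succ_add_choose (e i : ℕ) :
    ballot (2 * (e + 1) + i) i + (2 * (e + 1) + i).choose e = (2 * (e + 1) + i).choose (e + 1) := by
  induction e generalizing i with
  | zero =>
    induction i with
    | zero => decide
    | succ i ih =>
      have h : 2 * (0 + 1) + (i + 1) = (2 * (0 + 1) + i) + 1 := by ring
      rw [h, ballot, if_pos (by positivity)]
      have h1 : ballot (2 * (0 + 1) + i) (((i + 1 : ℕ) : ℤ) + 1) = 1 := by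
        have := ballot_self (2 * (0 + 1) + i)
        rwa [show ((2 * (0 + 1) + i : ℕ) : ℤ) = ((i + 1 : ℕ) : ℤ) + 1 by push_cast; ring] at this
      rw [h1]
      simp only [Nat.cast_succ, add_sub_cancel_right]
      simp at ih ⊢
      omega
  | succ e ihe =>
    induction i with
    | zero =>
      have h : 2 * (e + 1 + 1) + 0 = (2 * (e + 1) + 1) + 1 := by ring
      rw [h, ballot, if_pos (by positivity), ballot_of_neg _ (by simp)]
      have := ihe 1
      -- A path ending at 0 arrives from height 1, and the two middle binomials of the odd row
      -- agree.
      have hs : (2 * (e + 1) + 1).choose (e + 1 + 1) = (2 * (e + 1) + 1).choose (e + 1) :=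
        Nat.choose_symm_of_eq_add (by ring)
      rw [Nat.choose_succ_succ _ e, Nat.choose_succ_succ _ (e + 1)]
      simp only [Nat.succ_eq_add_one, Nat.cast_zero, Nat.cast_one, zero_add] at this hs ⊢
      omega
    | succ i ih =>
      have h : 2 * (e + 1 + 1) + (i + 1) = (2 * (e + 1 + 1) + i) + 1 := by ring
      rw [h, ballot, if_pos (by positivity)]
      have h1 := ihe (i + 2)
      have h2 : 2 * (e + 1) + (i + 2) = 2 * (e + 1 + 1) + i := by ring
      rw [h2] at h1
      have h3 : (((i + 1 : ℕ) : ℤ) + 1) = ((i + 2 : ℕ) : ℤ) := by push_cast; ring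
      rw [h3, Nat.choose_succ_succ _ e, Nat.choose_succ_succ _ (e + 1)]
      simp only [Nat.succ_eq_add_one, Nat.cast_add, Nat.cast_one, Nat.cast_ofNat,
        add_sub_cancel_right] at h1 ih ⊢
      omega

lemma ballot_mul (e i : ℕ) :
    ballot (2 * e + i) i * (e + i + 1) = (i + 1) * (2 * e + i).choose e := by
  cases e with
  | zero => simp [ballot_self]
  | succ e =>
    have h := ballot_succ_add_choose e i
    have h2 := Nat.choose_succ_right_eq (2 * (e + 1) + i) e
    rw [show 2 * (e + 1) + i - e = e + 2 + i by omega] at h2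
    zify at h h2 ⊢
    linear_combination (e + i + 2 : ℤ) * h + h2

lemma ballot_two_mul_zero (m : ℕ) : ballot (2 * m) 0 = catalan m := by
  have h := ballot_mul m 0
  have h2 := succ_mul_catalan_eq_centralBinom m
  rw [Nat.centralBinom] at h2
  refine Nat.eq_of_mul_eq_mul_left (Nat.succ_pos m) ?_
  rw [Nat.succ_eq_add_one, h2]
  simpa [mul_comm] using h

/-! ### Counting quarter plane walks by their last step. -/

lemma walksTo_succ (Y : Finset (ℤ × ℤ)) (n : ℕ) {p : ℤ × ℤ} (hp : 0 ≤ p.1 ∧ 0 ≤ p.2) :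
    walksTo Y (n + 1) p = ⋃ s ∈ (Y : Set (ℤ × ℤ)), (fun w => w ++ [s]) '' walksTo Y n (p - s) := by
  ext w
  simp only [Set.mem_iUnion, Set.mem_image, walksTo, IsQuarterPlaneWalk, Set.mem_ofPred_eq,
    Finset.mem_coe, exists_prop]
  constructor
  · rintro ⟨⟨hY, hk⟩, hl, hs⟩
    rcases List.eq_nil_or_concat w with rfl | ⟨v, s, rfl⟩
    · simp at hl
    · simp only [List.concat_eq_append, List.length_append, List.length_singleton,
        Nat.add_right_cancel_iff, List.sum_append, List.sum_singleton, List.mem_append,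
        List.mem_singleton] at *
      refine ⟨s, hY s (Or.inr rfl), v, ⟨⟨fun a ha => hY a (Or.inl ha), fun k hkv => ?_⟩, hl,
        eq_sub_of_add_eq hs⟩, rfl⟩
      have := hk k (by omega)
      rwa [List.take_append_of_le_length hkv] at this
  · rintro ⟨s, hs, v, ⟨⟨hY, hk⟩, hl, hv⟩, rfl⟩
    refine ⟨⟨fun a ha => ?_, fun k hkv => ?_⟩, by simp [hl], by simp [hv]⟩
    · rcases List.mem_append.1 ha with h | h
      · exact hY a h
      · rwa [List.mem_singleton.1 h]
    · rcases Nat.lt_or_ge v.length k with h | h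
      · rw [List.take_of_length_le (by simp; omega)]
        simpa [hv] using hp
      · rw [List.take_append_of_le_length h]
        exact hk k h

lemma walksTo_eq_empty (Y : Finset (ℤ × ℤ)) (n : ℕ) {p : ℤ × ℤ} (hp : ¬ (0 ≤ p.1 ∧ 0 ≤ p.2)) :
    walksTo Y n p = ∅ := by
  refine Set.eq_empty_of_forall_notMem fun w hw => hp ?_
  have := hw.1.2 w.length le_rfl
  rwa [List.take_length, hw.2.2] at this

lemma ncard_walksTo_succ (Y : Finset (ℤ × ℤ)) (n : ℕ) {p : ℤ × ℤ} (hp : 0 ≤ p.1 ∧ 0 ≤ p.2) :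
    (walksTo Y (n + 1) p).ncard = ∑ s ∈ Y, (walksTo Y n (p - s)).ncard := by
  have hinj (s : ℤ × ℤ) : Function.Injective fun w : List (ℤ × ℤ) => w ++ [s] :=
    List.append_left_injective _
  rw [walksTo_succ Y n hp, Set.Finite.ncard_biUnion Y.finite_toSet, finsum_mem_coe_finset]
  · exact Finset.sum_congr rfl fun s _ => Set.ncard_image_of_injective _ (hinj s)
  · exact fun s _ => ((finite_walks Y n).subset fun w hw => ⟨hw.1, hw.2.1⟩).image _
  · intro s _ s' _ hne
    refine Set.disjoint_left.2 ?_
    rintro _ ⟨v, -, rfl⟩ ⟨v', -, h⟩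
    have := List.append_inj_right' h rfl
    exact hne (List.singleton_inj.1 this).symm

lemma ncard_walksTo_zero (Y : Finset (ℤ × ℤ)) (p : ℤ × ℤ) :
    (walksTo Y 0 p).ncard = if p = 0 then 1 else 0 := by
  split_ifs with h
  · subst h
    rw [Set.ncard_eq_one]
    refine ⟨[], Set.ext fun w => ⟨fun hw => List.length_eq_zero_iff.1 hw.2.1, ?_⟩⟩
    rintro rfl
    exact ⟨⟨by simp, by simp⟩, rfl, rfl⟩
  · rw [Set.ncard_eq_zero ((finite_walks Y 0).subset fun w hw => ⟨hw.1, hw.2.1⟩)]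
    refine Set.eq_empty_of_forall_notMem fun w hw => h ?_
    rw [← hw.2.2, List.length_eq_zero_iff.1 hw.2.1, List.sum_nil]

lemma ncard_walksTo_stepsNSESW_succ (n : ℕ) {i j : ℤ} (hi : 0 ≤ i) (hj : 0 ≤ j) :
    (walksTo stepsNSESW (n + 1) (i, j)).ncard = (walksTo stepsNSESW n (i, j - 1)).ncard +
      (walksTo stepsNSESW n (i - 1, j + 1)).ncard + (walksTo stepsNSESW n (i + 1, j + 1)).ncard := by
  rw [ncard_walksTo_succ _ _ ⟨hi, hj⟩, stepsNSESW, Finset.sum_insert (by decide),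
    Finset.sum_insert (by decide), Finset.sum_singleton]
  simp [add_assoc]

/-- The vertical and the horizontal motion of a walk with steps `N`, `SE`, `SW` are independent. -/
lemma ncard_walksTo_stepsNSESW (n : ℕ) (i j : ℤ) :
    (walksTo stepsNSESW n (i, j)).ncard = ballot n j * ballot ((n - j) / 2).toNat i := by
  induction n generalizing i j with
  | zero =>
    rw [ncard_walksTo_zero, ballot]
    by_cases hj : j = 0
    · subst hj; simp [ballot]
    · simp [hj]
  | succ n ih =>
    by_cases hj : 0 ≤ j
    swap
    · rw [walksTo_eq_empty _ _ (by simp [hj]), ballot_of_neg _ (by omega)]; simp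
    by_cases hi : 0 ≤ i
    swap
    · rw [walksTo_eq_empty _ _ (by simp [hi]), ballot_of_neg _ (by omega : i < 0)]; simp
    rw [ncard_walksTo_stepsNSESW_succ n hi hj, ih, ih, ih, ballot, if_pos hj, add_mul, add_assoc,
      ← mul_add]
    congr 1
    · congr 3; push_cast; ring_nf
    -- The horizontal ballot number can be unfolded only if there is at least one down step; for `j
    -- ≥ n` the vertical factor vanishes instead.
    · rcases le_or_gt (n : ℤ) j with h | h
      · rw [ballot_of_lt n (by omega)]; simp
      · obtain ⟨d, hd⟩ : ∃ d : ℕ, (((n + 1 : ℕ) : ℤ) - j) / 2 = d + 1 :=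
          ⟨((n - 1 - j) / 2).toNat, by push_cast; omega⟩
        rw [hd, show ((n : ℤ) - (j + 1)) / 2 = d by push_cast at hd; omega,
          show ((d : ℤ) + 1).toNat = d + 1 by omega, Int.toNat_natCast, ballot, if_pos hi]

/-! ### The coefficients of `H` as walk counts. -/

lemma hCoeff_zero (n : ℕ) : hCoeff n 0 = 0 := by simp [hCoeff]

lemma hCoeff_succ (m k : ℕ) : hCoeff (m + 1) (k + 1) = catalan m * ballot (m + 1) k := by
  unfold hCoeff
  split_ifs with h
  · rw [ballot_of_odd _ (by push_cast; omega)]; simp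
  rcases Nat.lt_or_ge (m + 1) k with hk | hk
  · rw [ballot_of_lt _ (by omega), Nat.choose_eq_zero_of_lt (by omega)]; simp
  -- `e` is the number of down steps of a ballot path of length `m + 1` ending at height `k`.
  obtain ⟨e, he⟩ : ∃ e, m + 1 = 2 * e + k := ⟨(m + 1 - k) / 2, by omega⟩
  have h1 := ballot_mul e k
  have h2 := Nat.add_one_mul_choose_eq (2 * e + k) (e + k)
  rw [Nat.choose_symm_of_eq_add (show 2 * e + k = e + k + e by ring)] at h2
  have h3 : ((k : ℚ) + 1) / (2 * e + k + 1) * (2 * e + k + 1).choose (e + k + 1) =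
      ballot (2 * e + k) k := by
    have h1' : (ballot (2 * e + k) k * (e + k + 1) : ℚ) = (k + 1) * (2 * e + k).choose e := by
      exact_mod_cast h1
    have h2' : ((2 * e + k + 1) * (2 * e + k).choose e : ℚ) =
        (2 * e + k + 1).choose (e + k + 1) * (e + k + 1) := by exact_mod_cast h2
    have hne : (e + k + 1 : ℚ) ≠ 0 := by positivity
    refine mul_right_cancel₀ hne ?_
    rw [div_mul_eq_mul_div, div_mul_eq_mul_div, div_eq_iff (by positivity)]
    linear_combination (-(k : ℚ) - 1) * h2' - (2 * e + k + 1 : ℚ) * h1'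
  rw [he, show (2 * e + k + (k + 1) + 1) / 2 = e + k + 1 by omega, mul_assoc]
  have h4 : m = 2 * e + k - 1 := by omega
  push_cast
  rw [h3, h4]

/-- The walks ending on the `x`-axis, in terms of `hCoeff`. -/
lemma ncard_walksTo_boundary (m k : ℕ) :
    (((walksTo stepsNSESW (2 * m) ((k : ℤ) - 1, 0)).ncard : ℚ) +
      (walksTo stepsNSESW (2 * m) ((k : ℤ) + 1, 0)).ncard) = hCoeff (m + 1) (k + 1) := by
  rw [hCoeff_succ, ncard_walksTo_stepsNSESW, ncard_walksTo_stepsNSESW,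
    show ((((2 * m : ℕ) : ℤ) - 0) / 2).toNat = m by omega, ballot_two_mul_zero, ballot,
    if_pos (by positivity)]
  push_cast
  ring

lemma ncard_walksTo_odd (m : ℕ) (i : ℤ) :
    (walksTo stepsNSESW (2 * m + 1) (i, 0)).ncard = 0 := by
  rw [ncard_walksTo_stepsNSESW, ballot_of_odd _ (by push_cast; omega), zero_mul]

/-! ### Substituting a series for `x` in `A[x][[t]]`. -/

section DiagonalEvaluation

variable {A : Type*} [CommRing A]

/-- The value `F(G, t) = ∑ f_m(G) t^m` of `F = ∑ f_m(x) t^m` in `A[x][[t]]` at `x = G`. -/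
noncomputable def diagEval (G : PowerSeries A) (F : PowerSeries (Polynomial A)) : PowerSeries A :=
  PowerSeries.mk fun n => ∑ p ∈ Finset.HasAntidiagonal.antidiagonal n,
    PowerSeries.coeff p.2 ((PowerSeries.coeff p.1 F).eval₂ PowerSeries.C G)

lemma coeff_diagEval (G : PowerSeries A) (F : PowerSeries (Polynomial A)) (n : ℕ) :
    PowerSeries.coeff n (diagEval G F) = ∑ p ∈ Finset.HasAntidiagonal.antidiagonal n,
      PowerSeries.coeff p.2 ((PowerSeries.coeff p.1 F).eval₂ PowerSeries.C G) := by
  simp [diagEval]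

/-- Terms with `m > n` are divisible by a higher power of `t`, so identities for `diagEval` reduce
to finite sums. No condition on the constant term of `G` is needed. -/
lemma coeff_diagEval_eq_coeff_sum (G : PowerSeries A) (F : PowerSeries (Polynomial A))
    {n N : ℕ} (h : n ≤ N) :
    PowerSeries.coeff n (diagEval G F) = PowerSeries.coeff n (∑ m ∈ Finset.range (N + 1),
      PowerSeries.X ^ m * (PowerSeries.coeff m F).eval₂ PowerSeries.C G) := by
  rw [coeff_diagEval, Finset.Nat.sum_antidiagonal_eq_sum_range_succ_mk, map_sum]
  refine (Finset.sum_congr rfl fun m hm => ?_).trans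
    (Finset.sum_subset (Finset.range_subset_range.2 (Nat.succ_le_succ h)) fun m _ hm => ?_)
  · rw [PowerSeries.coeff_X_pow_mul', if_pos (by simpa [Nat.lt_succ_iff] using hm)]
  · rw [PowerSeries.coeff_X_pow_mul', if_neg (by simpa [Nat.lt_succ_iff] using hm)]

lemma diagEval_sub (G : PowerSeries A) (F F' : PowerSeries (Polynomial A)) :
    diagEval G (F - F') = diagEval G F - diagEval G F' := by
  ext n
  simp [coeff_diagEval, Polynomial.eval₂_sub, Finset.sum_sub_distrib]

lemma diagEval_C_mul (G : PowerSeries A) (p : Polynomial A) (F : PowerSeries (Polynomial A)) :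
    diagEval G (PowerSeries.C p * F) = p.eval₂ PowerSeries.C G * diagEval G F := by
  ext n
  rw [PowerSeries.coeff_mul, coeff_diagEval_eq_coeff_sum G _ le_rfl]
  have h : ∀ q ∈ Finset.HasAntidiagonal.antidiagonal n,
      PowerSeries.coeff q.1 (p.eval₂ PowerSeries.C G) * PowerSeries.coeff q.2 (diagEval G F) =
      PowerSeries.coeff q.1 (p.eval₂ PowerSeries.C G) * PowerSeries.coeff q.2
        (∑ m ∈ Finset.range (n + 1),
          PowerSeries.X ^ m * (PowerSeries.coeff m F).eval₂ PowerSeries.C G) := by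
    intro q hq
    rw [coeff_diagEval_eq_coeff_sum G F (N := n) (by have := Finset.HasAntidiagonal.mem_antidiagonal.1 hq; omega)]
  rw [Finset.sum_congr rfl h, ← PowerSeries.coeff_mul, Finset.mul_sum]
  congr 1
  refine Finset.sum_congr rfl fun m _ => ?_
  rw [PowerSeries.coeff_C_mul, Polynomial.eval₂_mul]
  ring

lemma diagEval_X_mul (G : PowerSeries A) (F : PowerSeries (Polynomial A)) :
    diagEval G (PowerSeries.X * F) = PowerSeries.X * diagEval G F := by
  ext n
  cases n with
  | zero => simp [coeff_diagEval]
  | succ n =>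
    rw [coeff_diagEval, Finset.Nat.sum_antidiagonal_succ, PowerSeries.coeff_succ_X_mul,
      coeff_diagEval]
    simp [PowerSeries.coeff_succ_X_mul]

lemma diagEval_mk_C (G : PowerSeries A) (r : ℕ → A) :
    diagEval G (PowerSeries.mk fun n => Polynomial.C (r n)) = PowerSeries.mk r := by
  ext n
  rw [coeff_diagEval, Finset.sum_eq_single (n, 0)]
  · simp
  · rintro ⟨a, b⟩ hab hne
    have hb : b ≠ 0 := by
      rintro rfl
      exact hne (by simpa using hab)
    simp [PowerSeries.coeff_C, hb]
  · simp

lemma diagEval_C (G : PowerSeries A) (p : Polynomial A) :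
    diagEval G (PowerSeries.C p) = p.eval₂ PowerSeries.C G := by
  have h1 : (1 : PowerSeries (Polynomial A)) =
      PowerSeries.mk fun n => Polynomial.C (PowerSeries.coeff n (1 : PowerSeries A)) := by
    ext n
    rcases n with _ | n <;> simp [PowerSeries.coeff_one]
  have := diagEval_C_mul G p 1
  rw [mul_one, h1, diagEval_mk_C] at this
  rw [this]
  convert mul_one _
  ext n
  simp

/-- Evaluation at a constant series is coefficientwise evaluation. -/
lemma coeff_diagEval_const (a : A) (F : PowerSeries (Polynomial A)) (n : ℕ) :
    PowerSeries.coeff n (diagEval (PowerSeries.C a) F) = (PowerSeries.coeff n F).eval a := by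
  have : diagEval (PowerSeries.C a) F =
      PowerSeries.mk fun n => (PowerSeries.coeff n F).eval a := by
    rw [← diagEval_mk_C (PowerSeries.C a)]
    ext n
    simp only [coeff_diagEval, PowerSeries.coeff_mk, Polynomial.eval₂_at_apply,
      Polynomial.eval₂_C]
  rw [this, PowerSeries.coeff_mk]

end DiagonalEvaluation

lemma substX_eq_diagEval (F : PowerSeries (Polynomial ℚ)) (G : LaurentXYSeries) :
    substX F G =
      diagEval G (PowerSeries.map (Polynomial.mapRingHom (algebraMap ℚ LaurentXY)) F) := by
  ext1 n
  rw [coeff_diagEval, substX, PowerSeries.coeff_mk]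
  refine Finset.sum_congr rfl fun p _ => ?_
  rw [PowerSeries.coeff_map, Polynomial.coe_mapRingHom, Polynomial.eval₂_map, Polynomial.aeval_def,
    Subsingleton.elim (algebraMap ℚ LaurentXYSeries) (PowerSeries.C.comp (algebraMap ℚ LaurentXY))]

/-! ### The kernel and its root `M`. -/

lemma mon_mul_mon (i j k l : ℤ) : mon i j * mon k l = mon (i + k) (j + l) := by
  simp [mon, AddMonoidAlgebra.single_mul_single]

lemma mon_zero_zero : mon 0 0 = 1 := rfl

lemma mon_zero_pow (j : ℤ) (n : ℕ) : mon 0 j ^ n = mon 0 (n * j) := by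
  induction n with
  | zero => simp [mon_zero_zero]
  | succ n ih => rw [pow_succ, ih, mon_mul_mon]; congr 1; push_cast; ring

lemma isUnit_mon (i j : ℤ) : IsUnit (mon i j) :=
  IsUnit.of_mul_eq_one (mon (-i) (-j)) (by rw [mon_mul_mon]; simp [mon_zero_zero])

lemma coeff_mon_mul (i j p q : ℤ) (a : LaurentXY) :
    (mon i j * a).coeff (p, q) = a.coeff (p - i, q - j) := by
  rw [mon, AddMonoidAlgebra.coeff_single_mul_apply]
  simp [neg_add_eq_sub]

lemma isUnit_kernelNSESW : IsUnit kernelNSESW := by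
  rw [PowerSeries.isUnit_iff_constantCoeff]
  simpa [kernelNSESW, xS, yS, tS, mon_mul_mon] using isUnit_mon 1 1

/-- A form of the quadratic equation of `M` that determines its coefficients recursively. -/
lemma quadratic_iff (M : LaurentXYSeries) :
    tS * M ^ 2 - (yS - tS * yS ^ 2) * M + tS = 0 ↔
      M = tS * (PowerSeries.C (mon 0 (-1)) * (1 + yS ^ 2 * M + M ^ 2)) := by
  have h : PowerSeries.C (mon 0 (-1)) * yS = 1 := by
    rw [yS, ← map_mul, mon_mul_mon]; simp [mon_zero_zero]
  constructor
  · intro hM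
    linear_combination -(PowerSeries.C (mon 0 (-1))) * hM - M * h
  · intro hM
    linear_combination -yS * hM - tS * (1 + yS ^ 2 * M + M ^ 2) * h

lemma quadratic_unique {M M' : LaurentXYSeries}
    (hM : tS * M ^ 2 - (yS - tS * yS ^ 2) * M + tS = 0)
    (hM' : tS * M' ^ 2 - (yS - tS * yS ^ 2) * M' + tS = 0) : M = M' := by
  have hu : IsUnit (yS - tS * yS ^ 2 - tS * (M + M')) := by
    rw [PowerSeries.isUnit_iff_constantCoeff]
    simpa [yS, tS] using isUnit_mon 0 1
  refine sub_eq_zero.1 (hu.mul_right_eq_zero.1 ?_)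
  linear_combination hM' - hM

lemma exists_quadratic :
    ∃ M : LaurentXYSeries, tS * M ^ 2 - (yS - tS * yS ^ 2) * M + tS = 0 := by
  have hu : IsUnit (yS - tS * yS ^ 2) := by
    rw [PowerSeries.isUnit_iff_constantCoeff]
    simpa [yS, tS] using isUnit_mon 0 1
  obtain ⟨v, hv⟩ := hu.exists_right_inv
  have hc : PowerSeries.HasSubst ((tS * v) ^ 2) :=
    PowerSeries.HasSubst.of_constantCoeff_zero' (by simp [tS])
  let K : PowerSeries LaurentXY :=
    PowerSeries.map (Nat.castRingHom LaurentXY) PowerSeries.catalanSeries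
  have hK : K ^ 2 * PowerSeries.X + 1 = K := by
    have := congrArg (PowerSeries.map (Nat.castRingHom LaurentXY))
      PowerSeries.catalanSeries_sq_mul_X_add_one
    simpa using this
  have hS := congrArg (PowerSeries.substAlgHom (R := LaurentXY) hc) hK
  rw [map_add, map_mul, map_pow, map_one, PowerSeries.substAlgHom_X] at hS
  -- With `b = y - ty²` and `v = b⁻¹`, the root is `(t/b) K(t²/b²)`, where `K = 1 + X K²` is the
  -- Catalan series.
  refine ⟨tS * v * PowerSeries.substAlgHom (R := LaurentXY) hc K, ?_⟩
  linear_combination tS * hS - tS * PowerSeries.substAlgHom (R := LaurentXY) hc K * hv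

/-- Completing the square: the root of the discriminant is `S = y - ty² - 2tM`, and `4t` can be
cancelled. -/
lemma isM_iff (M : LaurentXYSeries) :
    IsM M ↔ tS * M ^ 2 - (yS - tS * yS ^ 2) * M + tS = 0 := by
  constructor
  · rintro ⟨S, hS, -, hM⟩
    have h : (4 * tS) * (tS * M ^ 2 - (yS - tS * yS ^ 2) * M + tS) = 0 := by
      linear_combination hS + (2 * tS * M - (yS - tS * yS ^ 2) - S) * hM
    have h4 : (4 : LaurentXYSeries) ≠ 0 := by
      have : IsUnit (algebraMap ℚ LaurentXYSeries 4) :=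
        (IsUnit.mk0 (4 : ℚ) (by norm_num)).map (algebraMap ℚ LaurentXYSeries)
      rw [map_ofNat] at this
      exact this.ne_zero
    exact (mul_eq_zero.1 h).resolve_left (mul_ne_zero h4 PowerSeries.X_ne_zero)
  · intro hM
    refine ⟨yS - tS * yS ^ 2 - 2 * tS * M, ?_, by simp [yS, tS], by ring⟩
    linear_combination 4 * tS * hM

/-- The substitution `x = 1` in `ℚ[x, x⁻¹, y, y⁻¹]`. -/
noncomputable def evalXOne : LaurentXY →ₐ[ℚ] LaurentXY :=
  AddMonoidAlgebra.mapDomainAlgHom ℚ ℚ ((AddMonoidHom.inr ℤ ℤ).comp (AddMonoidHom.snd ℤ ℤ))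

lemma evalXOne_mon (i j : ℤ) : evalXOne (mon i j) = mon 0 j := by
  exact AddMonoidAlgebra.mapDomain_single

lemma coeff_evalXOne_of_ne (a : LaurentXY) {i : ℤ} (hi : i ≠ 0) (j : ℤ) :
    (evalXOne a).coeff (i, j) = 0 := by
  change (AddMonoidAlgebra.mapDomain _ a).coeff (i, j) = 0
  rw [AddMonoidAlgebra.coeff_mapDomain]
  refine Finsupp.mapDomain_of_notMem_range _ _ ?_
  rintro ⟨⟨k, l⟩, h⟩
  exact hi (congrArg Prod.fst h).symm

/-- `M` does not involve `x`: setting `x = 1` fixes the quadratic equation, hence by uniqueness its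
solution. -/
lemma quadratic_coeff_of_ne {M : LaurentXYSeries}
    (hM : tS * M ^ 2 - (yS - tS * yS ^ 2) * M + tS = 0) (n : ℕ) {i : ℤ} (hi : i ≠ 0) (j : ℤ) :
    (PowerSeries.coeff n M).coeff (i, j) = 0 := by
  have h := congrArg (PowerSeries.map (evalXOne : LaurentXY →+* LaurentXY)) hM
  have hy : PowerSeries.map (evalXOne : LaurentXY →+* LaurentXY) yS = yS := by
    simp [yS, evalXOne_mon]
  have ht : PowerSeries.map (evalXOne : LaurentXY →+* LaurentXY) tS = tS := by
    simp [tS]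
  simp only [map_add, map_sub, map_mul, map_pow, hy, ht, map_zero] at h
  rw [← quadratic_unique h hM, PowerSeries.coeff_map]
  exact coeff_evalXOne_of_ne _ hi j

lemma quadratic_coeff_succ {M : LaurentXYSeries}
    (hM : tS * M ^ 2 - (yS - tS * yS ^ 2) * M + tS = 0) (n : ℕ) :
    PowerSeries.coeff (n + 1) M = mon 0 (-1) * ((if n = 0 then 1 else 0) +
      mon 0 2 * PowerSeries.coeff n M + ∑ p ∈ Finset.HasAntidiagonal.antidiagonal n,
        PowerSeries.coeff p.1 M * PowerSeries.coeff p.2 M) := by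
  have h := congrArg (PowerSeries.coeff (n + 1)) ((quadratic_iff M).1 hM)
  have hy : yS ^ 2 = PowerSeries.C (mon 0 2) := by
    rw [yS, ← map_pow, mon_zero_pow]; rfl
  rwa [tS, PowerSeries.coeff_succ_X_mul, PowerSeries.coeff_C_mul, map_add, map_add, hy,
    PowerSeries.coeff_C_mul, pow_two, PowerSeries.coeff_mul, PowerSeries.coeff_one] at h

lemma quadratic_coeff_small {M : LaurentXYSeries}
    (hM : tS * M ^ 2 - (yS - tS * yS ^ 2) * M + tS = 0) :
    PowerSeries.coeff 0 M = 0 ∧ PowerSeries.coeff 1 M = mon 0 (-1) ∧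
      PowerSeries.coeff 2 M = 1 ∧ PowerSeries.coeff 3 M = mon 0 1 + mon 0 (-3) ∧
      PowerSeries.coeff 4 M = mon 0 2 + 3 * mon 0 (-2) := by
  have h0 : PowerSeries.coeff 0 M = 0 := by
    rw [(quadratic_iff M).1 hM, tS, PowerSeries.coeff_zero_X_mul]
  have h1 : PowerSeries.coeff 1 M = mon 0 (-1) := by
    rw [quadratic_coeff_succ hM 0]; simp [h0]
  have h2 : PowerSeries.coeff 2 M = 1 := by
    rw [quadratic_coeff_succ hM 1]
    simp [Finset.Nat.antidiagonal_succ, h0, h1, mon_mul_mon, mon_zero_zero]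
  have h3 : PowerSeries.coeff 3 M = mon 0 1 + mon 0 (-3) := by
    rw [quadratic_coeff_succ hM 2]
    simp [Finset.Nat.antidiagonal_succ, h0, h1, h2, mon_mul_mon, mul_add]
  have h4 : PowerSeries.coeff 4 M = mon 0 2 + 3 * mon 0 (-2) := by
    rw [quadratic_coeff_succ hM 3]
    simp [Finset.Nat.antidiagonal_succ, h0, h1, h2, h3, mon_mul_mon, mul_add]
    ring
  exact ⟨h0, h1, h2, h3, h4⟩

/-! ### The functional equation, with `x` as a polynomial variable so that `M` can replace it. -/

lemma ncard_walksTo_eq_zero {n : ℕ} {i j : ℤ} (h : i < 0 ∨ j < 0 ∨ n < i ∨ n < j) :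
    (walksTo stepsNSESW n (i, j)).ncard = 0 := by
  rw [ncard_walksTo_stepsNSESW]
  rcases lt_or_ge j 0 with hj | hj
  · rw [ballot_of_neg _ hj, zero_mul]
  rcases lt_or_ge (n : ℤ) j with hn | hn
  · rw [ballot_of_lt _ hn, zero_mul]
  rcases lt_or_ge i 0 with hi | hi
  · rw [ballot_of_neg _ hi, mul_zero]
  · rw [ballot_of_lt (j := i) _ (by omega), mul_zero]

/-- The generating polynomial in `y` of the walks of length `n` ending at abscissa `i`. -/
noncomputable def walkColumn (n : ℕ) (i : ℤ) : LaurentXY :=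
  ∑ j ∈ Finset.range (n + 1),
    AddMonoidAlgebra.single (0, (j : ℤ)) ((walksTo stepsNSESW n (i, j)).ncard : ℚ)

lemma coeff_walkColumn (n : ℕ) (i p q : ℤ) :
    (walkColumn n i).coeff (p, q) =
      if p = 0 then ((walksTo stepsNSESW n (i, q)).ncard : ℚ) else 0 := by
  rw [walkColumn, AddMonoidAlgebra.coeff_sum, Finsupp.finsetSum_apply]
  simp only [AddMonoidAlgebra.coeff_single, Finsupp.single_apply, Prod.mk.injEq]
  by_cases hp : p = 0
  · subst hp
    simp only [true_and, if_true]
    by_cases hq : 0 ≤ q ∧ q ≤ n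
    · lift q to ℕ using hq.1
      simp only [Nat.cast_inj, Finset.sum_ite_eq', Finset.mem_range]
      rw [if_pos (by omega)]
    · rw [ncard_walksTo_eq_zero (by omega)]
      refine Finset.sum_eq_zero fun j hj => if_neg ?_
      rw [Finset.mem_range] at hj
      omega
  · rw [if_neg hp]
    exact Finset.sum_eq_zero fun j _ => if_neg fun h => hp h.1.symm

lemma walkColumn_eq_zero {n : ℕ} {i : ℤ} (h : i < 0 ∨ n < i) : walkColumn n i = 0 := by
  ext ⟨p, q⟩
  rw [coeff_walkColumn, ncard_walksTo_eq_zero (by tauto)]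
  simp

/-- The generating polynomial of the walks of length `n`, as a polynomial in `x`. -/
noncomputable def walkPoly (n : ℕ) : Polynomial LaurentXY :=
  ∑ i ∈ Finset.range (n + 1), Polynomial.monomial i (walkColumn n i)

lemma coeff_walkPoly (n i : ℕ) : (walkPoly n).coeff i = walkColumn n i := by
  simp only [walkPoly, Polynomial.finsetSum_coeff, Polynomial.coeff_monomial, Finset.sum_ite_eq',
    Finset.mem_range]
  split_ifs with h
  · rfl
  · rw [walkColumn_eq_zero (by omega)]

lemma coeff_eval_walkPoly (n : ℕ) (i j : ℤ) :
    ((walkPoly n).eval (mon 1 0)).coeff (i, j) = (walksTo stepsNSESW n (i, j)).ncard := by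
  have hx (k : ℕ) : mon 1 0 ^ k = mon k 0 := by
    simp [mon, AddMonoidAlgebra.single_pow]
  rw [walkPoly, Polynomial.eval_finsetSum, AddMonoidAlgebra.coeff_sum, Finsupp.finsetSum_apply]
  simp only [Polynomial.eval_monomial, hx, mul_comm _ (mon _ _), coeff_mon_mul, coeff_walkColumn,
    sub_zero, sub_eq_zero]
  by_cases hi : 0 ≤ i ∧ i ≤ n
  · lift i to ℕ using hi.1
    simp only [Nat.cast_inj, Finset.sum_ite_eq, Finset.mem_range]
    rw [if_pos (by omega)]
  · rw [ncard_walksTo_eq_zero (by omega)]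
    refine Finset.sum_eq_zero fun k hk => if_neg ?_
    rw [Finset.mem_range] at hk
    omega

/-- The series `Q(x, y; t)` in `ℚ[y, y⁻¹][x][[t]]`. -/
noncomputable def walkSeries : PowerSeries (Polynomial LaurentXY) := PowerSeries.mk walkPoly

lemma diagEval_walkSeries : diagEval xS walkSeries = completeGF stepsNSESW := by
  ext n ⟨i, j⟩
  rw [xS, coeff_diagEval_const, coeff_completeGF, walkSeries, PowerSeries.coeff_mk,
    coeff_eval_walkPoly]

lemma walkPoly_zero : walkPoly 0 = 1 := by
  have : walkColumn 0 0 = 1 := by simp [walkColumn, ncard_walksTo_zero]; rfl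
  simp [walkPoly, this]

/-- The series `H(x, t)` in `ℚ[y, y⁻¹][x][[t]]`. -/
noncomputable def hSeriesLaurent : PowerSeries (Polynomial LaurentXY) :=
  PowerSeries.map (Polynomial.mapRingHom (algebraMap ℚ LaurentXY)) hSeries

/-- This identifies the positive powers of `x` in `H` with those of `t(x²+1)Q(x,0)`. -/
lemma coeff_hSeries_succ (n k : ℕ) :
    (PowerSeries.coeff (n + 1) hSeries).coeff (k + 1) =
      (walksTo stepsNSESW n ((k : ℤ) - 1, 0)).ncard +
        (walksTo stepsNSESW n ((k : ℤ) + 1, 0)).ncard := by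
  rcases Nat.even_or_odd' n with ⟨m, rfl | rfl⟩
  · rw [ncard_walksTo_boundary, ← coeff_hSeries_odd (m + 1) (k + 1) (by omega)]
    rfl
  · rw [ncard_walksTo_odd, ncard_walksTo_odd, show 2 * m + 1 + 1 = 2 * (m + 1) by ring,
      coeff_hSeries_even]
    simp

lemma coeff_hSeries_zero (n : ℕ) : (PowerSeries.coeff n hSeries).coeff 0 = 0 := by
  rcases Nat.even_or_odd' n with ⟨m, rfl | rfl⟩
  · simp [coeff_hSeries_even]
  · exact (coeff_hSeries_odd (m + 1) 0 (by omega)).trans (hCoeff_zero _)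

lemma coeff_hSeriesLaurent (n i : ℕ) (p q : ℤ) :
    ((PowerSeries.coeff n hSeriesLaurent).coeff i).coeff (p, q) =
      if p = 0 ∧ q = 0 then (PowerSeries.coeff n hSeries).coeff i else 0 := by
  rw [hSeriesLaurent, PowerSeries.coeff_map, Polynomial.coe_mapRingHom, Polynomial.coeff_map]
  change (AddMonoidAlgebra.single ((0 : ℤ), (0 : ℤ)) _).coeff (p, q) = _
  rw [AddMonoidAlgebra.coeff_single, Finsupp.single_apply]
  simp only [Prod.mk.injEq, eq_comm, Algebra.algebraMap_self_apply]

/-- The step recursion, coefficientwise in `x`. -/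
lemma walkColumn_succ (n i : ℕ) :
    mon 0 1 * walkColumn (n + 1) i = mon 0 2 * walkColumn n i + walkColumn n ((i : ℤ) - 1) +
      walkColumn n ((i : ℤ) + 1) - (PowerSeries.coeff (n + 1) hSeriesLaurent).coeff (i + 1) := by
  ext ⟨p, q⟩
  simp only [AddMonoidAlgebra.coeff_add, AddMonoidAlgebra.coeff_sub, Finsupp.add_apply,
    Finsupp.sub_apply, coeff_mon_mul, coeff_walkColumn, coeff_hSeriesLaurent, sub_zero]
  by_cases hp : p = 0
  swap
  · simp [hp]
  simp only [hp, true_and, if_true]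
  rcases lt_trichotomy q 0 with hq | rfl | hq
  · rw [ncard_walksTo_eq_zero (by omega), ncard_walksTo_eq_zero (by omega),
      ncard_walksTo_eq_zero (by omega), ncard_walksTo_eq_zero (by omega)]
    simp [hq.ne]
  -- After multiplication by `y`, exponent 0 stands for height -1: the two downward terms leaving
  -- the quadrant cancel against `H`.
  · rw [if_pos rfl, coeff_hSeries_succ, ncard_walksTo_eq_zero (by omega),
      ncard_walksTo_eq_zero (j := 0 - 2) (by omega)]
    simp
  · rw [ncard_walksTo_stepsNSESW_succ _ (by positivity) (by omega), if_neg hq.ne',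
      show q - 1 - 1 = q - 2 by ring, sub_add_cancel]
    push_cast
    ring

-- After multiplication by `x`, exponent 0 stands for abscissa -1; the last term removes the SW
-- steps from the y-axis.
open Polynomial in
lemma walkPoly_succ (n : ℕ) :
    C (mon 0 1) * X * walkPoly (n + 1) = (C (mon 0 2) * X + X ^ 2 + 1) * walkPoly n -
      PowerSeries.coeff (n + 1) hSeriesLaurent - C (walkColumn n 0) := by
  ext1 i
  have hh : (PowerSeries.coeff (n + 1) hSeriesLaurent).coeff 0 = 0 := by
    ext ⟨p, q⟩
    simp [coeff_hSeriesLaurent, coeff_hSeries_zero]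
  rcases i with _ | i
  · simp [mul_assoc, add_mul, pow_two, coeff_walkPoly, hh]
  · have h := walkColumn_succ n i
    rcases i with _ | i
    · have h1 : walkColumn n (-1) = 0 := walkColumn_eq_zero (by simp)
      simp [mul_assoc, add_mul, pow_two, coeff_walkPoly, h1] at h ⊢
      rw [h]
    · simp [mul_assoc, add_mul, pow_two, coeff_walkPoly] at h ⊢
      rw [h]

lemma walkSeries_functional_equation :
    PowerSeries.C (Polynomial.C (mon 0 1) * Polynomial.X) * walkSeries -
        PowerSeries.X * (PowerSeries.C (Polynomial.C (mon 0 2) * Polynomial.X +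
          Polynomial.X ^ 2 + 1) * walkSeries) =
      PowerSeries.C (Polynomial.C (mon 0 1) * Polynomial.X) - hSeriesLaurent -
        PowerSeries.X * PowerSeries.mk fun n => Polynomial.C (walkColumn n 0) := by
  ext1 n
  rcases n with _ | n
  · have : PowerSeries.coeff 0 hSeriesLaurent = 0 := by
      rw [hSeriesLaurent, PowerSeries.coeff_map, ← mul_zero 2, coeff_hSeries_even, map_zero]
    simp only [map_sub, PowerSeries.coeff_zero_X_mul, PowerSeries.coeff_C_mul, this, walkSeries,
      PowerSeries.coeff_mk, walkPoly_zero, PowerSeries.coeff_zero_C]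
    ring
  · simp only [map_sub, PowerSeries.coeff_succ_X_mul, PowerSeries.coeff_C_mul, walkSeries,
      PowerSeries.coeff_mk, PowerSeries.coeff_C, Nat.succ_ne_zero, if_false, walkPoly_succ]
    ring

/-- The functional equation evaluated at `x = G`. -/
lemma diagEval_functional_equation (G : LaurentXYSeries) :
    (yS * G - tS * (yS ^ 2 * G + G ^ 2 + 1)) * diagEval G walkSeries =
      yS * G - substX hSeries G - tS * PowerSeries.mk fun n => walkColumn n 0 := by
  have h := congrArg (diagEval G) walkSeries_functional_equation
  have hy : yS ^ 2 = PowerSeries.C (mon 0 2) := by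
    rw [yS, ← map_pow, mon_zero_pow]; rfl
  simp only [diagEval_sub, diagEval_C_mul, diagEval_X_mul, diagEval_C, diagEval_mk_C,
    Polynomial.eval₂_add, Polynomial.eval₂_mul, Polynomial.eval₂_C, Polynomial.eval₂_X,
    Polynomial.eval₂_pow, Polynomial.eval₂_one] at h
  rw [substX_eq_diagEval, hy]
  rw [hSeriesLaurent] at h
  change (PowerSeries.C (mon 0 1) * G - PowerSeries.X * _) * _ =
    PowerSeries.C (mon 0 1) * G - _ - PowerSeries.X * _
  linear_combination h

theorem mainTheorem5 :
    ∃ M : LaurentXYSeries, IsM M ∧ (∀ M' : LaurentXYSeries, IsM M' → M' = M) ∧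
      (∀ (n : ℕ) (i j : ℤ), i ≠ 0 → (PowerSeries.coeff n M).coeff (i, j) = 0) ∧
      tS * M ^ 2 - (yS - tS * yS ^ 2) * M + tS = 0 ∧
      PowerSeries.coeff 0 M = 0 ∧
      PowerSeries.coeff 1 M = mon 0 (-1) ∧
      PowerSeries.coeff 2 M = 1 ∧
      PowerSeries.coeff 3 M = mon 0 1 + mon 0 (-3) ∧
      PowerSeries.coeff 4 M = mon 0 2 + 3 * mon 0 (-2) ∧
      IsUnit kernelNSESW ∧
      completeGF stepsNSESW =
        (xS * yS - substX hSeries xS - yS * M + substX hSeries M) *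
          Ring.inverse kernelNSESW := by
  obtain ⟨M, hM⟩ := exists_quadratic
  obtain ⟨h0, h1, h2, h3, h4⟩ := quadratic_coeff_small hM
  refine ⟨M, (isM_iff M).2 hM, fun M' hM' => quadratic_unique ((isM_iff M').1 hM') hM,
    fun n i j hi => quadratic_coeff_of_ne hM n hi j, hM, h0, h1, h2, h3, h4,
    isUnit_kernelNSESW, ?_⟩
  have hx := diagEval_functional_equation xS
  have hG := diagEval_functional_equation M
  rw [diagEval_walkSeries] at hx
  rw [Ring.eq_mul_inverse_iff_mul_eq _ _ _ isUnit_kernelNSESW, kernelNSESW]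
  -- By `hM` the kernel vanishes at `x = M`, so `hG` expresses `tQ(0,y)` as `yM - H(M,t)`, which
  -- eliminates it from `hx`.
  linear_combination hx - hG - diagEval M walkSeries * hM
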